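/- **Setting.** Images are rectangular grids of $N_I=n_1n_2$ pixels observed in $N_W\ge 1$ energy bands; two pixels are neighbours if they share a pixel edge. A *model* $\psi=(R,\mu)$ consists of a region assignment function $R:\{\text{pixels}\}\to\{1,\dots,m\}$ all of whose regions $R_h=R^{-1}(h)$ are nonempty and connected, and of rates $\mu_{h,w}>0$ ($1\le h\le m$, $1\le w\le N_W$). Let $a_h$ be the number of pixels of $R_h$ and $b_h$ the number of pixel edges between $R_h$ and other regions. For one image $x=(x_{i,w})$ put $l(\psi;x)=\sum_w\sum_h\sum_{i\in R_h}[x_{i,w}\log\mu_{h,w}-\mu_{h,w}]$. Let $\mathcal M$ be any class of models. For $\boldsymbol\nu=(\nu_1,\dots,\nu_K)$ put $\nu_0=0$, $\nu_{K+1}=1$; for $\epsilon_\nu>0$ let $A^K_{\epsilon_\nu}$ be the set of $\boldsymbol\nu\in(0,1)^K$ with $\nu_1<\dots<\nu_K$ and $\nu_k-\nu_{k-1}>\epsilon_\nu$ for $1\le k\le K+1$. Given images $\mathbf Y_1,\dots,\mathbf Y_{T}$ and $\boldsymbol\psi=(\psi_1,\dots,\psi_{K+1})$, write $m^{(k)},a^{(k)}_h,b^{(k)}_h$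 for the quantities belonging to $\psi_k$, and let $$\mathrm{MDL}(K,\boldsymbol\nu,\boldsymbol\psi)=K\log T+\sum_{k=1}^{K+1}\Big[m^{(k)}\log N_I+\frac{\log 3}{2}\sum_h b^{(k)}_h+\frac{N_W}{2}\sum_h\log\big(([T\nu_k]-[T\nu_{k-1}]+1)\,a_h^{(k)}\big)\Big]-\sum_{k=1}^{K+1}\ \sum_{[T\nu_{k-1}]<t\le[T\nu_k]} l(\psi_k;\mathbf Y_t),$$ where $[\cdot]$ is the integer part. **Theorem.** Let $K^o\ge 0$, $\boldsymbol\nu^o\in A^{K^o}_{\epsilon_\nu}$ and $\psi^o_1,\dots,\psi^o_{K^o+1}\in\mathcal M$, $\psi^o_k=(R^{o(k)},\mu^{o(k)})$. For every $T$ let the counts $y_{i,t,w}$ ($1\le t\le T$) of the images $\mathbf Y_t$ be independent, with $y_{i,t,w}\sim\mathrm{Poisson}(\mu^{o(k)}_{R^{o(k)}(i),w})$ for $[T\nu^o_{k-1}]<t\le[T\nu^o_k]$ (all defined on one probability space, with an arbitrary joint law for different $T$). Assume that 1. in every interval $k$, any two different neighbouring regions $p,q$ of $R^{o(k)}$ satisfy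 $\mu^{o(k)}_{p,w}\ne\mu^{o(k)}_{q,w}$ for all bands $w$; 2. for every $1\le k\le K^o$ there are a pixel $i$ and a band $w$ with $\mu^{o(k+1)}_{R^{o(k+1)}(i),w}\neq\mu^{o(k)}_{R^{o(k)}(i),w}$. Suppose that $K^o$ is known and that, almost surely for all sufficiently large $T$, $(\hat{\boldsymbol\nu}_T,\hat{\boldsymbol\psi}_T)$ is a minimizer of $\frac1T\mathrm{MDL}(K^o,\boldsymbol\nu,\boldsymbol\psi)$ over $\boldsymbol\nu\in A^{K^o}_{\epsilon_\nu}$ and $\boldsymbol\psi\in\mathcal M^{K^o+1}$. Then, almost surely, $\hat{\boldsymbol\nu}_T\to\boldsymbol\nu^o$ as $T\to\infty$, and for all sufficiently large $T$ and every $1\le k\le K^o+1$ the estimated segmentation $\hat R^{(k)}$ is equal to $R^{o(k)}$ (up to the labelling of the regions) or an oversegmentation of it, i.e. $\hat R^{(k)}(i)=\hat R^{(k)}(j)$ implies $R^{o(k)}(i)=R^{o(k)}(j)$ for all pixels $i,j$. -/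

import Mathlib

open scoped BigOperators

noncomputable section

namespace ImageSeries

/-- The pixels of a rectangular image. -/
abbrev Pixel (n₁ n₂ : ℕ) : Type := Fin n₁ × Fin n₂

/-- The grid graph: two pixels are neighbours if and only if they share a pixel edge. -/
def grid (n₁ n₂ : ℕ) : SimpleGraph (Pixel n₁ n₂) :=
  (SimpleGraph.pathGraph n₁).boxProd (SimpleGraph.pathGraph n₂)

/-- A piecewise constant multi-band image model `ψ = (R, μ)`: the image is partitioned by a
region assignment function `R` into `m` nonempty connected regions, and `μ h w` is the (positive)
Poisson rate of region `h` in the energy band `w`. -/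
structure Model (n₁ n₂ W : ℕ) where
  /-- number of regions -/
  m : ℕ
  /-- region assignment function -/
  R : Pixel n₁ n₂ → Fin m
  /-- every region is connected (in particular nonempty) -/
  connected : ∀ h : Fin m, ((grid n₁ n₂).induce {i | R i = h}).Connected
  /-- Poisson rates -/
  μ : Fin m → Fin W → ℝ
  /-- the rates are positive -/
  μ_pos : ∀ h w, 0 < μ h w

namespace Model

variable {n₁ n₂ W : ℕ}

/-- The set of pixels in the region `h`. -/
def region (ψ : Model n₁ n₂ W) (h : Fin ψ.m) : Finset (Pixel n₁ n₂) :=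
  Finset.univ.filter fun i => ψ.R i = h

/-- The area `a_h`: number of pixels of the region `h`. -/
def area (ψ : Model n₁ n₂ W) (h : Fin ψ.m) : ℕ := (ψ.region h).card

/-- The perimeter `b_h`: number of pixel edges between the region `h` and the other regions. -/
def perimeter (ψ : Model n₁ n₂ W) (h : Fin ψ.m) : ℕ :=
  {p : Pixel n₁ n₂ × Pixel n₁ n₂ | (grid n₁ n₂).Adj p.1 p.2 ∧ ψ.R p.1 = h ∧ ψ.R p.2 ≠ h}.ncard

/-- Two different regions are neighbouring if some pixel of one is a neighbour of some pixel of
the other. -/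
def NeighbouringRegions (ψ : Model n₁ n₂ W) (p q : Fin ψ.m) : Prop :=
  p ≠ q ∧ ∃ i j, (grid n₁ n₂).Adj i j ∧ ψ.R i = p ∧ ψ.R j = q

/-- The log-likelihood `l(ψ; x)` of one multi-band image `x` (without the terms that do not depend
on the parameters). -/
def logLik (ψ : Model n₁ n₂ W) (x : Pixel n₁ n₂ → Fin W → ℕ) : ℝ :=
  ∑ w : Fin W, ∑ h : Fin ψ.m, ∑ i ∈ ψ.region h, ((x i w : ℝ) * Real.log (ψ.μ h w) - ψ.μ h w)

/-- The segmentation of `b` is an oversegmentation compared with that of `s` (equality of the two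
partitions is allowed). -/
def Oversegments (b s : Model n₁ n₂ W) : Prop :=
  ∀ i j, b.R i = b.R j → s.R i = s.R j

end Model

/-- The normalized change points `ν₁, …, ν_K` together with `ν₀ = 0` and `ν_{K+1} = 1`. -/
def extend {K : ℕ} (ν : Fin K → ℝ) : Fin (K + 2) → ℝ :=
  Fin.cons (α := fun _ => ℝ) 0 (Fin.snoc (α := fun _ => ℝ) ν 1)

/-- The constraint set `A_ε^K` for the normalized change points. -/
def admissible (K : ℕ) (ε : ℝ) : Set (Fin K → ℝ) :=
  {ν | (∀ k, 0 < ν k ∧ ν k < 1) ∧ StrictMono ν ∧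
    ∀ k : Fin (K + 1), ε < extend ν k.succ - extend ν k.castSucc}

/-- The change points `τ_k = [T ν_k]`, `0 ≤ k ≤ K + 1`, for `T` time bins. -/
def changePoint {K : ℕ} (T : ℕ) (ν : Fin K → ℝ) (k : Fin (K + 2)) : ℕ :=
  ⌊(T : ℝ) * extend ν k⌋₊

/-- The time bins `t ∈ (τ_{k-1}, τ_k]` of an interval; the index `k : Fin (K + 1)` starts at `0`. -/
def interval {K : ℕ} (T : ℕ) (ν : Fin K → ℝ) (k : Fin (K + 1)) : Finset ℕ :=
  Finset.Ioc (changePoint T ν k.castSucc) (changePoint T ν k.succ)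

/-- The code length of the parameters of one model that is fitted on an interval whose end points
differ by `len`. -/
def penalty {n₁ n₂ W : ℕ} (ψ : Model n₁ n₂ W) (len : ℝ) : ℝ :=
  (ψ.m : ℝ) * Real.log ((n₁ * n₂ : ℕ) : ℝ)
    + Real.log 3 / 2 * ∑ h : Fin ψ.m, (ψ.perimeter h : ℝ)
    + (W : ℝ) / 2 * ∑ h : Fin ψ.m, Real.log ((len + 1) * (ψ.area h : ℝ))

/-- The criterion `MDL(K, ν, ψ)` for the images `Y t`, `1 ≤ t ≤ T`. -/
def mdl {n₁ n₂ W K : ℕ} (T : ℕ) (Y : ℕ → Pixel n₁ n₂ → Fin W → ℕ)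
    (ν : Fin K → ℝ) (ψ : Fin (K + 1) → Model n₁ n₂ W) : ℝ :=
  (K : ℝ) * Real.log (T : ℝ)
    + ∑ k : Fin (K + 1),
        penalty (ψ k) ((changePoint T ν k.succ : ℝ) - (changePoint T ν k.castSucc : ℝ))
    - ∑ k : Fin (K + 1), ∑ t ∈ interval T ν k, (ψ k).logLik (Y t)

/-- `(ν, ψ)` minimizes `MDL(K, ·, ·) / T` over the admissible change points and over the models
from the class `𝓜`, the number `K` of change points being fixed. -/
def IsMDLEstimate {n₁ n₂ W K : ℕ} (ε : ℝ) (𝓜 : Set (Model n₁ n₂ W)) (T : ℕ)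
    (Y : ℕ → Pixel n₁ n₂ → Fin W → ℕ) (ν : Fin K → ℝ) (ψ : Fin (K + 1) → Model n₁ n₂ W) : Prop :=
  (ν ∈ admissible K ε ∧ ∀ k, ψ k ∈ 𝓜) ∧
    ∀ ν' ∈ admissible K ε, ∀ ψ' : Fin (K + 1) → Model n₁ n₂ W, (∀ k, ψ' k ∈ 𝓜) →
      1 / (T : ℝ) * mdl T Y ν ψ ≤ 1 / (T : ℝ) * mdl T Y ν' ψ'

open MeasureTheory ProbabilityTheory in
/-- `y T t i w` (`1 ≤ t ≤ T`) are, for every number `T` of time bins, independent Poisson counts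
that follow the model with the normalized change points `ν` and the parameters `ψ`. Nothing is
required of the joint law of the arrays for different `T`. -/
structure IsObserved {Ω : Type*} [MeasurableSpace Ω] (P : Measure Ω) {n₁ n₂ W K : ℕ}
    (ν : Fin K → ℝ) (ψ : Fin (K + 1) → Model n₁ n₂ W)
    (y : ℕ → ℕ → Pixel n₁ n₂ → Fin W → Ω → ℕ) : Prop where
  indep : ∀ T : ℕ, iIndepFun
    (fun p : Finset.Icc 1 T × Pixel n₁ n₂ × Fin W => y T (p.1 : ℕ) p.2.1 p.2.2) P
  law : ∀ (T : ℕ) (k : Fin (K + 1)), ∀ t ∈ interval T ν k, ∀ i w,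
    HasLaw (y T t i w) (poissonMeasure (Real.toNNReal ((ψ k).μ ((ψ k).R i) w))) P

end ImageSeries

end

noncomputable section

namespace ImageSeries

open MeasureTheory ProbabilityTheory Filter Topology
open scoped NNReal ENNReal

/-! Divided by `T`, the penalty of the true model vanishes and that of the estimate is nonnegative,
so minimality makes the fitted log-likelihood per time bin asymptotically at least the true one. Let
`n` and `s` be the normalized length and count of a fitted interval. Then `s log r - n r` falls
short of its maximum, attained at `r = s / n`, by `n` times a Poisson divergence. If the fitted
change points converge, `s / n` tends to the average of the true rates weighted by overlaps. The
maximal minus the true likelihood then tends to minus a sum of divergences of true rates from these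
averages, yet it dominates the nonnegative shortfalls. Both sums therefore vanish in the limit
(`tendsto_rate_of_le_likelihood`): true rates are constant on each limit interval, and fitted rates
converge to them. Since consecutive true images differ, no limit interval crosses a true change
point, and equality of the numbers of change points forces the limit to be the truth
(`eq_of_overlap`). Compactness of the cube removes the convergence assumption. Pixels on two sides
of a true boundary have different limit rates, so they are eventually separated; connectedness of
the fitted regions gives the oversegmentation (`Model.oversegments_of_adj`). Randomness enters only
through a strong law at fixed rational times (`ae_tendsto_poisson_average`), by Chernoff bounds and
Borel–Cantelli. Monotonicity of counts in time extends it to data-dependent change points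
(`tendsto_apply_of_monotone`). -/

/-! ### Deviations and the strong law for Poisson sums. -/

lemma integrable_exp_mul_poissonMeasure (r : ℝ≥0) (θ : ℝ) :
    Integrable (fun n : ℕ => Real.exp (θ * n)) (poissonMeasure r) ∧
      ∫ n : ℕ, Real.exp (θ * n) ∂(poissonMeasure r) = Real.exp (r * (Real.exp θ - 1)) := by
  have key : HasSum (fun n : ℕ => Real.exp (-r) * r ^ n / n.factorial * Real.exp (θ * n))
      (Real.exp (r * (Real.exp θ - 1))) := by
    have h := (NormedSpace.expSeries_div_hasSum_exp (𝔸 := ℝ) (r * Real.exp θ)).mul_left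
      (Real.exp (-r))
    rw [← Real.exp_eq_exp_ℝ, ← Real.exp_add] at h
    convert h using 1
    · rfl
    · funext n
      rw [mul_pow, ← Real.exp_nat_mul, mul_comm (n : ℝ) θ]
      ring
    · congr 1; ring
  have hint : Integrable (fun n : ℕ => Real.exp (θ * n)) (poissonMeasure r) := by
    rw [integrable_poissonMeasure_iff]
    refine key.summable.congr fun n => ?_
    rw [Real.norm_of_nonneg (Real.exp_pos _).le]
  refine ⟨hint, ?_⟩
  have := hasSum_integral_poissonMeasure hint
  simp only [smul_eq_mul] at this
  exact this.unique key

section PoissonSum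

variable {Ω : Type*} [MeasurableSpace Ω] {P : Measure Ω}

lemma mgf_poisson {X : Ω → ℕ} {r : ℝ≥0} (hX : HasLaw X (poissonMeasure r) P) (θ : ℝ) :
    mgf (fun ω => (X ω : ℝ)) P θ = Real.exp (r * (Real.exp θ - 1)) := by
  rw [← (integrable_exp_mul_poissonMeasure r θ).2]
  exact hX.integral_comp (f := fun n : ℕ => Real.exp (θ * n))
    (measurable_of_countable _).aestronglyMeasurable

variable {ι : Type*} [Fintype ι] {Z : ι → Ω → ℕ} {r : ℝ≥0}

lemma mgf_sum_poisson (hind : iIndepFun Z P) (hlaw : ∀ t, HasLaw (Z t) (poissonMeasure r) P)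
    (θ : ℝ) : Integrable (fun ω => Real.exp (θ * ∑ t, (Z t ω : ℝ))) P ∧
      mgf (fun ω => ∑ t, (Z t ω : ℝ)) P θ
        = Real.exp (Fintype.card ι * r * (Real.exp θ - 1)) := by
  have hind' : iIndepFun (fun t ω => (Z t ω : ℝ)) P :=
    hind.comp (fun _ (n : ℕ) => (n : ℝ)) fun _ => measurable_of_countable _
  have hmeas : ∀ t, AEMeasurable (fun ω => (Z t ω : ℝ)) P := fun t =>
    (measurable_of_countable (fun n : ℕ => (n : ℝ))).comp_aemeasurable (hlaw t).aemeasurable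
  have hsum : (fun ω => ∑ t, (Z t ω : ℝ)) = ∑ t, fun ω => (Z t ω : ℝ) := by
    funext ω; simp
  have hm : mgf (fun ω => ∑ t, (Z t ω : ℝ)) P θ
      = Real.exp (Fintype.card ι * r * (Real.exp θ - 1)) := by
    rw [hsum, hind'.mgf_sum₀ hmeas, Finset.prod_congr rfl fun t _ => mgf_poisson (hlaw t) θ,
      Finset.prod_const, ← Real.exp_nat_mul, Finset.card_univ]
    congr 1; ring
  refine ⟨?_, hm⟩
  -- The integral of a non-integrable function is `0` by convention, but the value just found is
  -- positive.
  by_contra hcon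
  have h0 : mgf (fun ω => ∑ t, (Z t ω : ℝ)) P θ = 0 := integral_undef hcon
  rw [hm] at h0
  exact (Real.exp_pos _).ne' h0

/-- Chernoff's bound in both tails, with `exp u - 1 - u ≤ u ^ 2` for `|u| ≤ 1`. Only an upper bound
`N` of the number of summands enters, so short windows of time bins are covered with the same
exponent. -/
lemma measureReal_poisson_deviation_le [IsProbabilityMeasure P] (hind : iIndepFun Z P)
    (hlaw : ∀ t, HasLaw (Z t) (poissonMeasure r) P) {N : ℝ} (hN : (Fintype.card ι : ℝ) ≤ N)
    {θ : ℝ} (hθ : 0 ≤ θ) (hθ1 : θ ≤ 1) (δ : ℝ) :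
    P.real {ω | δ * N ≤ |∑ t, (Z t ω : ℝ) - Fintype.card ι * r|}
      ≤ 2 * Real.exp (N * (r * θ ^ 2 - θ * δ)) := by
  set S : Ω → ℝ := fun ω => ∑ t, (Z t ω : ℝ) with hS
  set m : ℝ := Fintype.card ι * r with hm
  have hm0 : 0 ≤ m := by positivity
  have hmN : m ≤ N * r := mul_le_mul_of_nonneg_right hN r.2
  have hexp : ∀ u : ℝ, |u| ≤ 1 → m * (Real.exp u - 1 - u) ≤ N * r * u ^ 2 := fun u hu => by
    have h1 := (le_abs_self _).trans (Real.abs_exp_sub_one_sub_id_le hu)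
    nlinarith [sq_nonneg u]
  have hup : P.real {ω | m + δ * N ≤ S ω} ≤ Real.exp (N * (r * θ ^ 2 - θ * δ)) := by
    refine (measure_ge_le_exp_mul_mgf _ hθ (mgf_sum_poisson hind hlaw θ).1).trans ?_
    rw [(mgf_sum_poisson hind hlaw θ).2, ← Real.exp_add]
    refine Real.exp_le_exp.2 ?_
    have := hexp θ (by rwa [abs_of_nonneg hθ])
    rw [← hm]
    linarith
  have hlow : P.real {ω | S ω ≤ m - δ * N} ≤ Real.exp (N * (r * θ ^ 2 - θ * δ)) := by
    refine (measure_le_le_exp_mul_mgf _ (neg_nonpos.2 hθ)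
      (mgf_sum_poisson hind hlaw (-θ)).1).trans ?_
    rw [(mgf_sum_poisson hind hlaw (-θ)).2, ← Real.exp_add]
    refine Real.exp_le_exp.2 ?_
    have := hexp (-θ) (by rwa [abs_neg, abs_of_nonneg hθ])
    rw [← hm]
    linarith
  have hsub : {ω | δ * N ≤ |S ω - m|} ⊆ {ω | m + δ * N ≤ S ω} ∪ {ω | S ω ≤ m - δ * N} := by
    intro ω hω
    simp only [Set.mem_ofPred_eq, Set.mem_union] at hω ⊢
    rcases le_abs.1 hω with h | h
    · left; linarith
    · right; linarith
  calc P.real {ω | δ * N ≤ |S ω - m|}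
      ≤ P.real ({ω | m + δ * N ≤ S ω} ∪ {ω | S ω ≤ m - δ * N}) := measureReal_mono hsub
    _ ≤ _ := measureReal_union_le _ _
    _ ≤ _ := by linarith

end PoissonSum

/-- A strong law of large numbers for triangular arrays of Poisson variables. -/
theorem ae_tendsto_poisson_average {Ω : Type*} [MeasurableSpace Ω] {P : Measure Ω}
    [IsProbabilityMeasure P] {Z : ℕ → ℕ → Ω → ℕ} {s : ℕ → Finset ℕ} {r : ℝ≥0} {c : ℝ}
    (hind : ∀ T, iIndepFun (fun t : s T => Z T t) P)
    (hlaw : ∀ T, ∀ t ∈ s T, HasLaw (Z T t) (poissonMeasure r) P)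
    (hcard : ∀ T, (s T).card ≤ T)
    (hc : Tendsto (fun T : ℕ => ((s T).card : ℝ) / T) atTop (𝓝 c)) :
    ∀ᵐ ω ∂P, Tendsto (fun T : ℕ => (∑ t ∈ s T, (Z T t ω : ℝ)) / T) atTop (𝓝 (r * c)) := by
  have hdev : ∀ δ : ℝ, 0 < δ → ∀ᵐ ω ∂P, ∀ᶠ T : ℕ in atTop,
      |∑ t ∈ s T, (Z T t ω : ℝ) - (s T).card * r| < δ * T := by
    intro δ hδ
    obtain ⟨θ, hθ0, hθ1, hθ⟩ : ∃ θ : ℝ, 0 ≤ θ ∧ θ ≤ 1 ∧ (r : ℝ) * θ ^ 2 - θ * δ < 0 := by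
      have hden : 0 < (r : ℝ) + δ := add_pos_of_nonneg_of_pos r.2 hδ
      -- This choice stays in `[0, 1]` even for `r = 0` and gives the exponent `-δ ^ 3 / (r + δ) ^
      -- 2`.
      refine ⟨δ / (r + δ), by positivity, (div_le_one hden).2 (by linarith [r.2]), ?_⟩
      have : (r : ℝ) * (δ / (r + δ)) ^ 2 - δ / (r + δ) * δ = - (δ ^ 3 / (r + δ) ^ 2) := by
        field_simp; ring
      rw [this]
      have : 0 < δ ^ 3 / ((r : ℝ) + δ) ^ 2 := by positivity
      linarith
    have hb : ∀ T : ℕ, P.real {ω | δ * T ≤ |∑ t ∈ s T, (Z T t ω : ℝ) - (s T).card * r|}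
        ≤ 2 * Real.exp ((r : ℝ) * θ ^ 2 - θ * δ) ^ T := by
      intro T
      have := measureReal_poisson_deviation_le (hind T) (fun t => hlaw T t t.2)
        (N := (T : ℝ)) (by simpa using hcard T) hθ0 hθ1 δ
      rw [Real.exp_nat_mul] at this
      have hsum : ∀ ω, ∑ t : s T, (Z T t ω : ℝ) = ∑ t ∈ s T, (Z T t ω : ℝ) := fun ω =>
        Finset.sum_coe_sort (s T) fun t => (Z T t ω : ℝ)
      simpa only [hsum, Fintype.card_coe] using this
    have hsum : Summable fun T : ℕ =>
        P.real {ω | δ * T ≤ |∑ t ∈ s T, (Z T t ω : ℝ) - (s T).card * r|} :=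
      Summable.of_nonneg_of_le (fun _ => measureReal_nonneg) hb
        ((summable_geometric_of_lt_one (Real.exp_pos _).le (Real.exp_lt_one_iff.2 hθ)).mul_left 2)
    have hfin : ∑' T : ℕ, P {ω | δ * T ≤ |∑ t ∈ s T, (Z T t ω : ℝ) - (s T).card * r|} ≠ ∞ := by
      have := hsum.tsum_ofReal_ne_top
      simpa [ofReal_measureReal] using this
    -- The first Borel–Cantelli lemma needs no independence between different `T`.
    filter_upwards [ae_eventually_notMem hfin] with ω hω
    filter_upwards [hω] with T hT
    simpa using hT
  have hdev' : ∀ᵐ ω ∂P, ∀ n : ℕ, ∀ᶠ T : ℕ in atTop,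
      |∑ t ∈ s T, (Z T t ω : ℝ) - (s T).card * r| < 1 / ((n : ℝ) + 1) * T :=
    ae_all_iff.2 fun n => hdev _ Nat.one_div_pos_of_nat
  filter_upwards [hdev'] with ω hω
  have h0 : Tendsto (fun T : ℕ => (∑ t ∈ s T, (Z T t ω : ℝ) - (s T).card * r) / T) atTop
      (𝓝 0) := by
    rw [Metric.tendsto_atTop']
    intro η hη
    obtain ⟨n, hn⟩ := exists_nat_one_div_lt hη
    obtain ⟨N, hN⟩ := eventually_atTop.1 (hω n)
    refine ⟨N, fun T hT => ?_⟩
    have hT0 : (0 : ℝ) < T := by exact_mod_cast (Nat.zero_le N).trans_lt hT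
    rw [Real.dist_eq, sub_zero, abs_div, abs_of_pos hT0, div_lt_iff₀ hT0]
    exact (hN T hT.le).trans (mul_lt_mul_of_pos_right hn hT0)
  have h1 := h0.add (hc.const_mul (r : ℝ))
  rw [zero_add] at h1
  refine h1.congr fun T => ?_
  ring

/-! ### Poisson divergence and the likelihood comparison. -/

/-- The Kullback-Leibler divergence of two Poisson laws with the rates `x` and `r`. -/
def poissonDiv (x r : ℝ) : ℝ := x * Real.log (x / r) - x + r

/-- The inequality `log z ≤ z - 1` at `z = √r / √x`. This Hellinger-type bound controls `r` with no
a priori bounds on the fitted rates. -/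
lemma sq_sqrt_sub_sqrt_le_poissonDiv {x r : ℝ} (hx : 0 ≤ x) (hr : 0 < r) :
    (Real.sqrt x - Real.sqrt r) ^ 2 ≤ poissonDiv x r := by
  unfold poissonDiv
  rcases hx.eq_or_lt with rfl | hx
  · simp [Real.sq_sqrt hr.le]
  have hsx := Real.sqrt_pos.2 hx
  have hsr := Real.sqrt_pos.2 hr
  have hlog := Real.log_le_sub_one_of_pos (div_pos hsr hsx)
  have heq : Real.log (x / r) = -2 * Real.log (Real.sqrt r / Real.sqrt x) := by
    rw [Real.log_div hx.ne' hr.ne', Real.log_div hsr.ne' hsx.ne', Real.log_sqrt hx.le,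
      Real.log_sqrt hr.le]
    ring
  have h1 : x * (Real.sqrt r / Real.sqrt x) = Real.sqrt x * Real.sqrt r := by
    nth_rewrite 1 [← Real.mul_self_sqrt hx.le]
    field_simp
  rw [heq]
  nlinarith [Real.sq_sqrt hx.le, Real.sq_sqrt hr.le, mul_le_mul_of_nonneg_left hlog hx.le]

lemma poissonDiv_nonneg {x r : ℝ} (hx : 0 ≤ x) (hr : 0 < r) : 0 ≤ poissonDiv x r :=
  (sq_nonneg _).trans (sq_sqrt_sub_sqrt_le_poissonDiv hx hr)

lemma eq_of_poissonDiv_eq_zero {x r : ℝ} (hx : 0 ≤ x) (hr : 0 < r) (h : poissonDiv x r = 0) :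
    x = r := by
  have h1 := sq_sqrt_sub_sqrt_le_poissonDiv hx hr
  rw [h] at h1
  have h2 : Real.sqrt x - Real.sqrt r = 0 := by
    have := le_antisymm h1 (sq_nonneg _)
    simpa using this
  exact (Real.sqrt_inj hx hr.le).1 (sub_eq_zero.1 h2)

lemma tendsto_of_poissonDiv_tendsto_zero {α : Type*} {F : Filter α} {x r : α → ℝ} {ρ : ℝ}
    (hx0 : ∀ᶠ a in F, 0 ≤ x a) (hr : ∀ a, 0 < r a) (hρ : 0 ≤ ρ) (hx : Tendsto x F (𝓝 ρ))
    (h : Tendsto (fun a => poissonDiv (x a) (r a)) F (𝓝 0)) : Tendsto r F (𝓝 ρ) := by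
  have h1 : Tendsto (fun a => (Real.sqrt (x a) - Real.sqrt (r a)) ^ 2) F (𝓝 0) :=
    tendsto_of_tendsto_of_tendsto_of_le_of_le' tendsto_const_nhds h
      (Eventually.of_forall fun _ => sq_nonneg _)
      (hx0.mono fun a ha => sq_sqrt_sub_sqrt_le_poissonDiv ha (hr a))
  have h2 : Tendsto (fun a => Real.sqrt (x a) - Real.sqrt (r a)) F (𝓝 0) := by
    rw [tendsto_zero_iff_abs_tendsto_zero]
    have := (Real.continuous_sqrt.tendsto 0).comp h1
    simpa [Function.comp_def, Real.sqrt_sq_eq_abs] using this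
  have h3 := (((Real.continuous_sqrt.tendsto ρ).comp hx).sub h2).pow 2
  rw [sub_zero, Real.sq_sqrt hρ] at h3
  refine h3.congr fun a => ?_
  simp [Real.sq_sqrt (hr a).le]

/-- The left side is the likelihood at its maximizer `s / n`, so the divergence term is the exact
loss from using the rate `r`. -/
lemma mul_log_sub_eq_add_poissonDiv {s n r : ℝ} (hs : 0 ≤ s) (hn : 0 < n) (hr : 0 < r) :
    s * Real.log (s / n) - s = (s * Real.log r - n * r) + n * poissonDiv (s / n) r := by
  unfold poissonDiv
  rcases hs.eq_or_lt with rfl | hs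
  · simp
  rw [Real.log_div (div_pos hs hn).ne' hr.ne']
  field_simp
  ring

/-- If the likelihood of rates fitted on the intervals is asymptotically at least that of the true
rates, then the fitted rates converge, and the true rates are constant on the limit intervals. -/
theorem tendsto_rate_of_le_likelihood {α κ ι : Type*} [Fintype κ] [Fintype ι] {F : Filter α}
    [F.NeBot] {n : α → κ → ℝ} {s r : α → κ → ι → ℝ} {B : α → ℝ} {o : κ → κ → ℝ} {lam : κ → ι → ℝ}
    (ho : ∀ k j, 0 ≤ o k j) (hlam : ∀ k p, 0 < lam k p) (hpos : ∀ k, 0 < ∑ j, o k j)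
    (hn : ∀ k, Tendsto (fun a => n a k) F (𝓝 (∑ j, o k j)))
    (hs : ∀ k p, Tendsto (fun a => s a k p) F (𝓝 (∑ j, o k j * lam j p)))
    (hs0 : ∀ a k p, 0 ≤ s a k p) (hr : ∀ a k p, 0 < r a k p)
    (hB : Tendsto B F
      (𝓝 (∑ j, ∑ p, (∑ k, o k j) * (lam j p * Real.log (lam j p) - lam j p))))
    (hle : ∀ᶠ a in F, B a ≤ ∑ k, ∑ p, (s a k p * Real.log (r a k p) - n a k * r a k p)) :
    (∀ k j p, 0 < o k j → lam j p = (∑ j, o k j * lam j p) / ∑ j, o k j) ∧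
      ∀ k p, Tendsto (fun a => r a k p) F (𝓝 ((∑ j, o k j * lam j p) / ∑ j, o k j)) := by
  set N : κ → ℝ := fun k => ∑ j, o k j with hN
  set S : κ → ι → ℝ := fun k p => ∑ j, o k j * lam j p with hS
  have hSpos : ∀ k p, 0 < S k p := by
    intro k p
    obtain ⟨j, -, hj⟩ := (Finset.sum_pos_iff_of_nonneg fun j _ => ho k j).1 (hpos k)
    exact (Finset.sum_pos_iff_of_nonneg fun j _ => mul_nonneg (ho k j) (hlam j p).le).2
      ⟨j, Finset.mem_univ j, mul_pos hj (hlam j p)⟩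
  have hx : ∀ k p, Tendsto (fun a => s a k p / n a k) F (𝓝 (S k p / N k)) := fun k p =>
    (hs k p).div (hn k) (hpos k).ne'
  have hρ : ∀ k p, 0 < S k p / N k := fun k p => div_pos (hSpos k p) (hpos k)
  have hnpos : ∀ᶠ a in F, ∀ k, 0 < n a k :=
    eventually_all.2 fun k => (hn k).eventually (lt_mem_nhds (hpos k))
  -- `Q` is the excess of the best likelihood on the fitted intervals over the benchmark `B`. It
  -- dominates the fitted divergences, while its limit is nonpositive.
  set Q : α → ℝ := fun a =>
    (∑ k, ∑ p, (s a k p * Real.log (s a k p / n a k) - s a k p)) - B a with hQ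
  have hQlim : Tendsto Q F (𝓝 (-∑ k, ∑ p, ∑ j, o k j * poissonDiv (lam j p) (S k p / N k))) := by
    have h1 : Tendsto Q F (𝓝 ((∑ k, ∑ p, (S k p * Real.log (S k p / N k) - S k p)) -
        ∑ j, ∑ p, (∑ k, o k j) * (lam j p * Real.log (lam j p) - lam j p))) := by
      refine Tendsto.sub (tendsto_finsetSum _ fun k _ => tendsto_finsetSum _ fun p _ => ?_) hB
      exact ((hs k p).mul ((hx k p).log (hρ k p).ne')).sub (hs k p)
    convert h1 using 2
    have h2 : ∑ j, ∑ p, (∑ k, o k j) * (lam j p * Real.log (lam j p) - lam j p)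
        = ∑ k, ∑ p, ∑ j, o k j * (lam j p * Real.log (lam j p) - lam j p) := by
      simp_rw [Finset.sum_mul]
      rw [Finset.sum_comm]
      rw [Finset.sum_congr rfl fun p _ => Finset.sum_comm]
      rw [Finset.sum_comm]
    rw [h2, ← Finset.sum_sub_distrib, ← Finset.sum_neg_distrib]
    refine Finset.sum_congr rfl fun k _ => ?_
    rw [← Finset.sum_sub_distrib, ← Finset.sum_neg_distrib]
    refine Finset.sum_congr rfl fun p _ => ?_
    have h3 : ∀ j, o k j * poissonDiv (lam j p) (S k p / N k)
        = o k j * (lam j p * Real.log (lam j p) - lam j p)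
          - o k j * lam j p * Real.log (S k p / N k) + o k j * (S k p / N k) := by
      intro j
      unfold poissonDiv
      rw [Real.log_div (hlam j p).ne' (hρ k p).ne']
      ring
    simp_rw [h3]
    rw [Finset.sum_add_distrib, Finset.sum_sub_distrib, ← Finset.sum_mul, ← Finset.sum_mul]
    -- Because `S / N` is the weighted average of the true rates, the terms linear in them collapse
    -- to `S log (S / N)` and `S`.
    change -(_ - S k p * _ + N k * (S k p / N k)) = _
    rw [mul_div_cancel₀ _ (hpos k).ne']
    ring
  have hQle : ∀ᶠ a in F, ∑ k, ∑ p, n a k * poissonDiv (s a k p / n a k) (r a k p) ≤ Q a := by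
    filter_upwards [hle, hnpos] with a ha han
    have : ∀ k p, n a k * poissonDiv (s a k p / n a k) (r a k p)
        = (s a k p * Real.log (s a k p / n a k) - s a k p)
          - (s a k p * Real.log (r a k p) - n a k * r a k p) := fun k p => by
      rw [mul_log_sub_eq_add_poissonDiv (hs0 a k p) (han k) (hr a k p)]
      ring
    simp_rw [this, Finset.sum_sub_distrib]
    simp_rw [Finset.sum_sub_distrib] at ha
    simp_rw [hQ, Finset.sum_sub_distrib]
    linarith
  have hterm : ∀ᶠ a in F, ∀ k p, 0 ≤ n a k * poissonDiv (s a k p / n a k) (r a k p) := by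
    filter_upwards [hnpos] with a han k p
    exact mul_nonneg (han k).le (poissonDiv_nonneg (div_nonneg (hs0 a k p) (han k).le) (hr a k p))
  have hoterm : ∀ k p j, 0 ≤ o k j * poissonDiv (lam j p) (S k p / N k) := fun k p j =>
    mul_nonneg (ho k j) (poissonDiv_nonneg (hlam j p).le (hρ k p))
  have hD : ∑ k, ∑ p, ∑ j, o k j * poissonDiv (lam j p) (S k p / N k) = 0 := by
    refine le_antisymm ?_ (Finset.sum_nonneg fun k _ => Finset.sum_nonneg fun p _ =>
      Finset.sum_nonneg fun j _ => hoterm k p j)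
    rw [← neg_nonneg]
    refine ge_of_tendsto hQlim ?_
    filter_upwards [hQle, hterm] with a h1 h2
    exact (Finset.sum_nonneg fun k _ => Finset.sum_nonneg fun p _ => h2 k p).trans h1
  constructor
  · intro k j p hkj
    have h1 := (Finset.sum_eq_zero_iff_of_nonneg fun k _ => Finset.sum_nonneg fun p _ =>
      Finset.sum_nonneg fun j _ => hoterm k p j).1 hD k (Finset.mem_univ _)
    have h2 := (Finset.sum_eq_zero_iff_of_nonneg fun p _ =>
      Finset.sum_nonneg fun j _ => hoterm k p j).1 h1 p (Finset.mem_univ _)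
    have h3 := (Finset.sum_eq_zero_iff_of_nonneg fun j _ => hoterm k p j).1 h2 j
      (Finset.mem_univ _)
    exact eq_of_poissonDiv_eq_zero (hlam j p).le (hρ k p)
      ((mul_eq_zero.1 h3).resolve_left hkj.ne')
  · intro k p
    rw [hD, neg_zero] at hQlim
    have h1 : Tendsto (fun a => n a k * poissonDiv (s a k p / n a k) (r a k p)) F (𝓝 0) := by
      refine tendsto_of_tendsto_of_tendsto_of_le_of_le' tendsto_const_nhds hQlim
        (hterm.mono fun a ha => ha k p) ?_
      filter_upwards [hQle, hterm] with a h1 h2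
      refine le_trans ?_ h1
      refine le_trans ?_ (Finset.single_le_sum (fun k _ => Finset.sum_nonneg fun p _ => h2 k p)
        (Finset.mem_univ k))
      exact Finset.single_le_sum (f := fun p => n a k * poissonDiv (s a k p / n a k) (r a k p))
        (fun p _ => h2 k p) (Finset.mem_univ p)
    have h2 : Tendsto (fun a => poissonDiv (s a k p / n a k) (r a k p)) F (𝓝 0) := by
      have := h1.div (hn k) (hpos k).ne'
      rw [zero_div] at this
      refine this.congr' ?_
      filter_upwards [hnpos] with a ha
      simp [mul_div_cancel_left₀ _ (ha k).ne']
    exact tendsto_of_poissonDiv_tendsto_zero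
      (hnpos.mono fun a ha => div_nonneg (hs0 a k p) (ha k).le) (fun a => hr a k p)
      (hρ k p).le (hx k p) h2

/-! ### Change points and sums over time bins. -/

variable {K : ℕ}

lemma extend_zero (ν : Fin K → ℝ) : extend ν 0 = 0 := by simp [extend]

lemma extend_last (ν : Fin K → ℝ) : extend ν (Fin.last (K + 1)) = 1 := by
  rw [← Fin.succ_last]
  simp only [extend, Fin.cons_succ, Fin.snoc_last]

lemma extend_castSucc_succ (ν : Fin K → ℝ) (k : Fin K) : extend ν k.castSucc.succ = ν k := by
  simp [extend]

lemma continuous_extend (k : Fin (K + 2)) : Continuous fun ν : Fin K → ℝ => extend ν k := by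
  induction k using Fin.cases with
  | zero => simpa only [extend_zero] using continuous_const
  | succ k =>
    induction k using Fin.lastCases with
    | last => simpa only [Fin.succ_last, extend_last] using continuous_const
    | cast k => simpa only [extend_castSucc_succ] using continuous_apply k

lemma strictMono_extend {ε : ℝ} (hε : 0 ≤ ε) {ν : Fin K → ℝ} (hν : ν ∈ admissible K ε) :
    StrictMono (extend ν) :=
  Fin.strictMono_iff_lt_succ.2 fun k => by linarith [hν.2.2 k]

lemma extend_nonneg {ν : Fin K → ℝ} (h : Monotone (extend ν)) (k : Fin (K + 2)) :
    0 ≤ extend ν k := (extend_zero ν).symm.le.trans (h (Fin.zero_le k))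

lemma extend_le_one {ν : Fin K → ℝ} (h : Monotone (extend ν)) (k : Fin (K + 2)) :
    extend ν k ≤ 1 := (h (Fin.le_last k)).trans (extend_last ν).le

lemma changePoint_zero (T : ℕ) (ν : Fin K → ℝ) : changePoint T ν 0 = 0 := by
  simp [changePoint, extend_zero]

lemma changePoint_last (T : ℕ) (ν : Fin K → ℝ) : changePoint T ν (Fin.last (K + 1)) = T := by
  simp [changePoint, extend_last]

lemma monotone_changePoint (T : ℕ) {ν : Fin K → ℝ} (h : Monotone (extend ν)) :
    Monotone (changePoint T ν) := fun _ _ hab =>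
  Nat.floor_mono (mul_le_mul_of_nonneg_left (h hab) T.cast_nonneg)

lemma changePoint_le (T : ℕ) {ν : Fin K → ℝ} (h : Monotone (extend ν)) (k : Fin (K + 2)) :
    changePoint T ν k ≤ T :=
  (monotone_changePoint T h (Fin.le_last k)).trans (changePoint_last T ν).le

lemma sum_fin_succ_sub_castSucc {n : ℕ} (g : Fin (n + 1) → ℝ) :
    ∑ j : Fin n, (g j.succ - g j.castSucc) = g (Fin.last n) - g 0 := by
  induction n with
  | zero => simp
  | succ n ih =>
    rw [Fin.sum_univ_castSucc]
    have := ih fun k => g k.castSucc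
    simp only [Fin.castSucc_zero] at this
    simp only [Fin.succ_castSucc, this, Fin.succ_last]
    ring

lemma sum_Ioc_eq_sub (f : ℕ → ℝ) {a b : ℕ} (h : a ≤ b) :
    ∑ t ∈ Finset.Ioc a b, f t = ∑ t ∈ Finset.Ioc 0 b, f t - ∑ t ∈ Finset.Ioc 0 a, f t := by
  rw [← Finset.sum_Ioc_consecutive f (Nat.zero_le a) h]
  ring

/-- The time bins of the interval `j` up to the normalized time `u`. -/
def binsUpTo (T : ℕ) (ν : Fin K → ℝ) (j : Fin (K + 1)) (u : ℝ) : Finset ℕ :=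
  Finset.Ioc (changePoint T ν j.castSucc) (min ⌊(T : ℝ) * u⌋₊ (changePoint T ν j.succ))

/-- The length of the part of the interval `(e j, e (j + 1)]` before the time `u`. -/
def lengthUpTo (e : Fin (K + 2) → ℝ) (j : Fin (K + 1)) (u : ℝ) : ℝ :=
  min u (e j.succ) - min u (e j.castSucc)

lemma binsUpTo_subset_interval (T : ℕ) (ν : Fin K → ℝ) (j : Fin (K + 1)) (u : ℝ) :
    binsUpTo T ν j u ⊆ interval T ν j :=
  Finset.Ioc_subset_Ioc_right (min_le_right _ _)

lemma interval_subset {ν : Fin K → ℝ} (h : Monotone (extend ν)) (T : ℕ) (j : Fin (K + 1)) :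
    interval T ν j ⊆ Finset.Icc 1 T := fun t ht => by
  have h1 := Finset.mem_Ioc.1 ht
  exact Finset.mem_Icc.2 ⟨(Nat.zero_le _).trans_lt h1.1, h1.2.trans (changePoint_le T h _)⟩

lemma binsUpTo_mono (T : ℕ) (ν : Fin K → ℝ) (j : Fin (K + 1)) : Monotone (binsUpTo T ν j) :=
  fun _ _ huv => Finset.Ioc_subset_Ioc_right (min_le_min_right _
    (Nat.floor_mono (mul_le_mul_of_nonneg_left huv T.cast_nonneg)))

lemma sum_binsUpTo {ν : Fin K → ℝ} (h : Monotone (extend ν)) (T : ℕ) (f : ℕ → ℝ)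
    (j : Fin (K + 1)) (u : ℝ) :
    ∑ t ∈ binsUpTo T ν j u, f t
      = ∑ t ∈ Finset.Ioc 0 (min ⌊(T : ℝ) * u⌋₊ (changePoint T ν j.succ)), f t
        - ∑ t ∈ Finset.Ioc 0 (min ⌊(T : ℝ) * u⌋₊ (changePoint T ν j.castSucc)), f t := by
  have hab := monotone_changePoint T h (Fin.castSucc_lt_succ (i := j)).le
  rcases le_total (changePoint T ν j.castSucc) ⌊(T : ℝ) * u⌋₊ with hc | hc
  · rw [min_eq_right hc, binsUpTo, sum_Ioc_eq_sub f (le_min hc hab)]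
  -- If `u` precedes the interval, both truncated sums agree and the set of bins is empty.
  · rw [min_eq_left hc, min_eq_left (hc.trans hab), sub_self, binsUpTo,
      min_eq_left (hc.trans hab), Finset.Ioc_eq_empty (not_lt.2 hc), Finset.sum_empty]

lemma sum_sum_binsUpTo {ν : Fin K → ℝ} (h : Monotone (extend ν)) (T : ℕ) (f : ℕ → ℝ) {u : ℝ}
    (hu : u ≤ 1) :
    ∑ j, ∑ t ∈ binsUpTo T ν j u, f t = ∑ t ∈ Finset.Ioc 0 ⌊(T : ℝ) * u⌋₊, f t := by
  simp_rw [sum_binsUpTo h]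
  rw [sum_fin_succ_sub_castSucc fun k =>
    ∑ t ∈ Finset.Ioc 0 (min ⌊(T : ℝ) * u⌋₊ (changePoint T ν k)), f t]
  have : ⌊(T : ℝ) * u⌋₊ ≤ T := by
    refine (Nat.floor_mono (mul_le_mul_of_nonneg_left hu T.cast_nonneg)).trans ?_
    simp
  simp [changePoint_zero, changePoint_last, this]

/-- The sum over an interval of one segmentation is split along the intervals of another one. -/
lemma sum_interval_eq {νo ν : Fin K → ℝ} (ho : Monotone (extend νo)) (h : Monotone (extend ν))
    (T : ℕ) (f : ℕ → ℝ) (k : Fin (K + 1)) :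
    ∑ t ∈ interval T ν k, f t
      = ∑ j, (∑ t ∈ binsUpTo T νo j (extend ν k.succ), f t
        - ∑ t ∈ binsUpTo T νo j (extend ν k.castSucc), f t) := by
  rw [Finset.sum_sub_distrib, sum_sum_binsUpTo ho T f (extend_le_one h _),
    sum_sum_binsUpTo ho T f (extend_le_one h _)]
  exact sum_Ioc_eq_sub f (monotone_changePoint T h (Fin.castSucc_lt_succ (i := k)).le)

lemma card_interval {ν : Fin K → ℝ} (h : Monotone (extend ν)) (T : ℕ) (k : Fin (K + 1)) :
    ((interval T ν k).card : ℝ)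
      = (changePoint T ν k.succ : ℝ) - (changePoint T ν k.castSucc : ℝ) := by
  rw [interval, Nat.card_Ioc,
    Nat.cast_sub (monotone_changePoint T h (Fin.castSucc_lt_succ (i := k)).le)]

/-- The natural floor of a negative number is `0`, hence the `max`; negative times occur because all
rational times are used. -/
lemma tendsto_floor_mul_div (u : ℝ) :
    Tendsto (fun T : ℕ => (⌊(T : ℝ) * u⌋₊ : ℝ) / T) atTop (𝓝 (max u 0)) := by
  rcases le_total 0 u with hu | hu
  · rw [max_eq_left hu]
    have := (tendsto_nat_floor_mul_div_atTop hu).comp (tendsto_natCast_atTop_atTop (R := ℝ))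
    simpa [Function.comp_def, mul_comm] using this
  · rw [max_eq_right hu]
    refine tendsto_const_nhds.congr fun T => ?_
    rw [Nat.floor_of_nonpos (mul_nonpos_of_nonneg_of_nonpos T.cast_nonneg hu)]
    simp

lemma tendsto_card_binsUpTo {ν : Fin K → ℝ} (h : Monotone (extend ν)) (j : Fin (K + 1)) (u : ℝ) :
    Tendsto (fun T : ℕ => ((binsUpTo T ν j u).card : ℝ) / T) atTop
      (𝓝 (lengthUpTo (extend ν) j (max u 0))) := by
  have hfl : ∀ k, Tendsto (fun T : ℕ => (changePoint T ν k : ℝ) / T) atTop (𝓝 (extend ν k)) :=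
    fun k => by simpa [changePoint, max_eq_left (extend_nonneg h k)] using tendsto_floor_mul_div (extend ν k)
  have hlim := ((tendsto_floor_mul_div u).min (hfl j.succ)).sub
    ((tendsto_floor_mul_div u).min (hfl j.castSucc))
  refine hlim.congr fun T => ?_
  have h1 := sum_binsUpTo h T (fun _ => 1) j u
  simp only [Finset.sum_const, nsmul_eq_mul, mul_one, Nat.card_Ioc, Nat.sub_zero,
    Nat.cast_min] at h1
  rw [h1, sub_div, min_div_div_right T.cast_nonneg, min_div_div_right T.cast_nonneg]

/-- Pointwise convergence of monotone functions on the rationals to a continuous limit implies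
convergence along convergent arguments. -/
lemma tendsto_apply_of_monotone {G : ℕ → ℝ → ℝ} {g : ℝ → ℝ} (hG : ∀ T, Monotone (G T))
    (hg : Continuous g) (h : ∀ q : ℚ, Tendsto (fun T => G T q) atTop (𝓝 (g q)))
    {F : Filter ℕ} (hF : F ≤ atTop) {u : ℕ → ℝ} {v : ℝ} (hu : Tendsto u F (𝓝 v)) :
    Tendsto (fun T => G T (u T)) F (𝓝 (g v)) := by
  refine tendsto_order.2 ⟨fun a ha => ?_, fun a ha => ?_⟩
  -- A fixed rational just below `v` is eventually below `u T`, and there the limit already exceeds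
  -- `a`; the other bound is symmetric.
  · obtain ⟨l, hl, hlv⟩ := exists_Ioc_subset_of_mem_nhds (hg.continuousAt.eventually
      (lt_mem_nhds ha)) ⟨v - 1, by linarith⟩
    obtain ⟨q, hq1, hq2⟩ := exists_rat_btwn hl
    filter_upwards [hF ((h q).eventually (lt_mem_nhds (hlv ⟨hq1, hq2.le⟩))),
      hu.eventually (lt_mem_nhds hq2)] with T h1 h2
    exact h1.trans_le (hG T h2.le)
  · obtain ⟨l, hl, hlv⟩ := exists_Ico_subset_of_mem_nhds (hg.continuousAt.eventually
      (gt_mem_nhds ha)) ⟨v + 1, by linarith⟩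
    obtain ⟨q, hq1, hq2⟩ := exists_rat_btwn hl
    filter_upwards [hF ((h q).eventually (gt_mem_nhds (hlv ⟨hq1.le, hq2⟩))),
      hu.eventually (gt_mem_nhds hq1)] with T h1 h2
    exact (hG T h2.le).trans_lt h1

lemma continuous_lengthUpTo (e : Fin (K + 2) → ℝ) (j : Fin (K + 1)) :
    Continuous (lengthUpTo e j) := by
  unfold lengthUpTo
  fun_prop

lemma monotone_lengthUpTo {e : Fin (K + 2) → ℝ} (he : Monotone e) (j : Fin (K + 1)) :
    Monotone (lengthUpTo e j) := fun u v huv => by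
  have := he (Fin.castSucc_lt_succ (i := j)).le
  unfold lengthUpTo
  grind

/-! ### Overlaps of two segmentations of time. -/

/-- The length of the intersection of the interval `k` of `e'` with the interval `j` of `e`. -/
def overlap (e e' : Fin (K + 2) → ℝ) (k j : Fin (K + 1)) : ℝ :=
  lengthUpTo e j (e' k.succ) - lengthUpTo e j (e' k.castSucc)

lemma overlap_nonneg {e e' : Fin (K + 2) → ℝ} (he : Monotone e) (he' : Monotone e')
    (k j : Fin (K + 1)) : 0 ≤ overlap e e' k j :=
  sub_nonneg.2 (monotone_lengthUpTo he j (he' (Fin.castSucc_lt_succ (i := k)).le))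

lemma overlap_pos {e e' : Fin (K + 2) → ℝ} {k j : Fin (K + 1)}
    (h : max (e j.castSucc) (e' k.castSucc) < min (e j.succ) (e' k.succ)) :
    0 < overlap e e' k j := by
  unfold overlap lengthUpTo
  grind

lemma sum_overlap_right {ν ν' : Fin K → ℝ} (h' : Monotone (extend ν')) (k : Fin (K + 1)) :
    ∑ j, overlap (extend ν) (extend ν') k j = extend ν' k.succ - extend ν' k.castSucc := by
  have : ∀ u, 0 ≤ u → u ≤ 1 → ∑ j, lengthUpTo (extend ν) j u = u := fun u h0 h1 => by
    unfold lengthUpTo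
    rw [sum_fin_succ_sub_castSucc fun k => min u (extend ν k), extend_last, extend_zero,
      min_eq_left h1, min_eq_right h0, sub_zero]
  unfold overlap
  rw [Finset.sum_sub_distrib, this _ (extend_nonneg h' _) (extend_le_one h' _),
    this _ (extend_nonneg h' _) (extend_le_one h' _)]

lemma sum_overlap_left {ν ν' : Fin K → ℝ} (h : Monotone (extend ν)) (j : Fin (K + 1)) :
    ∑ k, overlap (extend ν) (extend ν') k j = extend ν j.succ - extend ν j.castSucc := by
  unfold overlap
  rw [sum_fin_succ_sub_castSucc fun k => lengthUpTo (extend ν) j (extend ν' k), extend_last,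
    extend_zero]
  unfold lengthUpTo
  rw [min_eq_right (extend_le_one h _), min_eq_right (extend_le_one h _),
    min_eq_left (extend_nonneg h _), min_eq_left (extend_nonneg h _)]
  ring

/-- Two segmentations coincide if no interval of the second one meets two adjacent intervals of
the first one. -/
lemma eq_of_overlap {ν ν' : Fin K → ℝ} (h : StrictMono (extend ν)) (h' : StrictMono (extend ν'))
    (hov : ∀ k : Fin (K + 1), ∀ j : Fin K, 0 < overlap (extend ν) (extend ν') k j.castSucc →
      ¬ 0 < overlap (extend ν) (extend ν') k j.succ) : ν' = ν := by
  have hmono : ∀ {η : Fin K → ℝ}, StrictMono (extend η) → StrictMono η := fun {η} hη a b hab => by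
    have := hη (Fin.succ_lt_succ_iff.2 (Fin.castSucc_lt_castSucc_iff.2 hab))
    rwa [extend_castSucc_succ, extend_castSucc_succ] at this
  -- A change point of `ν` missed by `ν'` lies strictly inside an interval of `ν'`, which then meets
  -- both adjacent intervals of `ν`.
  have hmem : ∀ j, ν j ∈ Set.range ν' := by
    intro j
    by_contra hj
    have hj0 : 0 < ν j := by
      rw [← extend_castSucc_succ ν j, ← extend_zero ν]
      exact h (Fin.succ_pos _)
    have hj1 : ν j < 1 := by
      rw [← extend_castSucc_succ ν j, ← extend_last ν]
      exact h (by rw [← Fin.succ_last, Fin.succ_lt_succ_iff]; exact Fin.castSucc_lt_last j)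
    have hne : ∀ k, extend ν' k ≠ ν j := by
      intro k
      induction k using Fin.cases with
      | zero => rw [extend_zero]; exact hj0.ne
      | succ k =>
        induction k using Fin.lastCases with
        | last => rw [Fin.succ_last, extend_last]; exact hj1.ne'
        | cast k => rw [extend_castSucc_succ]; exact fun hk => hj ⟨k, hk⟩
    obtain ⟨k, hk1, hk2⟩ : ∃ k : Fin (K + 1), extend ν' k.castSucc < ν j ∧
        ν j < extend ν' k.succ := by
      by_contra! hcon
      have : ∀ k : Fin (K + 2), extend ν' k < ν j := by
        intro k
        induction k using Fin.induction with
        | zero => rw [extend_zero]; exact hj0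
        | succ k ih => exact lt_of_le_of_ne (hcon k ih) (hne _)
      have := this (Fin.last _)
      rw [extend_last] at this
      linarith
    have h1 : extend ν j.castSucc.succ = ν j := extend_castSucc_succ ν j
    have h2 : extend ν j.succ.castSucc = ν j := by rw [← Fin.succ_castSucc, h1]
    have h3 := h (Fin.castSucc_lt_succ (i := j.castSucc))
    have h4 := h (Fin.castSucc_lt_succ (i := j.succ))
    rw [h1] at h3
    rw [h2] at h4
    refine hov k j (overlap_pos ?_) (overlap_pos ?_)
    · rw [h1]; exact lt_min (max_lt h3 hk1) (max_lt (h3.trans hk2) (hk1.trans hk2))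
    · rw [h2]; exact lt_min (max_lt h4 (hk1.trans h4)) (max_lt hk2 (hk1.trans hk2))
  have hsub : Set.range ν ⊆ Set.range ν' := by
    rintro _ ⟨j, rfl⟩
    exact hmem j
  -- Both ranges have `K` elements, so the inclusion is an equality, and a strictly increasing
  -- enumeration is determined by its range.
  have hcard : (Set.range ν').ncard ≤ (Set.range ν).ncard := by
    rw [← Set.image_univ, ← Set.image_univ, Set.ncard_image_of_injective _ (hmono h).injective,
      Set.ncard_image_of_injective _ (hmono h').injective]
  exact ((hmono h').range_inj (hmono h)).1
    (Set.eq_of_subset_of_ncard_le hsub hcard (Set.finite_range _)).symm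

/-! ### Pixelwise likelihood and connected regions. -/

namespace Model

variable {n₁ n₂ W : ℕ}

/-- The rate of the pixel `p.1` in the band `p.2`. -/
def rate (ψ : Model n₁ n₂ W) (p : Pixel n₁ n₂ × Fin W) : ℝ := ψ.μ (ψ.R p.1) p.2

lemma rate_pos (ψ : Model n₁ n₂ W) (p : Pixel n₁ n₂ × Fin W) : 0 < ψ.rate p := ψ.μ_pos _ _

lemma logLik_eq_sum_rate (ψ : Model n₁ n₂ W) (x : Pixel n₁ n₂ → Fin W → ℕ) :
    ψ.logLik x = ∑ p : Pixel n₁ n₂ × Fin W, ((x p.1 p.2 : ℝ) * Real.log (ψ.rate p) - ψ.rate p) := by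
  rw [Fintype.sum_prod_type_right, logLik]
  refine Finset.sum_congr rfl fun w _ => ?_
  rw [← Finset.sum_fiberwise (s := Finset.univ) (g := ψ.R)]
  refine Finset.sum_congr rfl fun h _ => Finset.sum_congr rfl fun i hi => ?_
  simp only [rate, (Finset.mem_filter.1 hi).2]

lemma sum_logLik (ψ : Model n₁ n₂ W) (s : Finset ℕ) (Y : ℕ → Pixel n₁ n₂ → Fin W → ℕ) :
    ∑ t ∈ s, ψ.logLik (Y t) = ∑ p : Pixel n₁ n₂ × Fin W,
      ((∑ t ∈ s, (Y t p.1 p.2 : ℝ)) * Real.log (ψ.rate p) - s.card * ψ.rate p) := by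
  simp_rw [logLik_eq_sum_rate]
  rw [Finset.sum_comm]
  simp [Finset.sum_sub_distrib, Finset.sum_mul]

lemma exists_pixel (ψ : Model n₁ n₂ W) (h : Fin ψ.m) : ∃ i, ψ.R i = h := by
  obtain ⟨i, hi⟩ := (ψ.connected h).nonempty
  exact ⟨i, hi⟩

lemma one_le_area (ψ : Model n₁ n₂ W) (h : Fin ψ.m) : 1 ≤ ψ.area h := by
  obtain ⟨i, hi⟩ := ψ.exists_pixel h
  exact Finset.card_pos.2 ⟨i, Finset.mem_filter.2 ⟨Finset.mem_univ i, hi⟩⟩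

/-- A segmentation that separates all neighbouring pixels of different regions of `s` is an
oversegmentation of `s`. -/
lemma oversegments_of_adj {b s : Model n₁ n₂ W}
    (h : ∀ i j, (grid n₁ n₂).Adj i j → s.R i ≠ s.R j → b.R i ≠ b.R j) : b.Oversegments s := by
  intro i j hij
  have hreach := (b.connected (b.R j)).preconnected ⟨i, hij⟩ ⟨j, rfl⟩
  rw [SimpleGraph.reachable_iff_reflTransGen] at hreach
  -- Along a path inside one region of `b`, no step can change the label of `s`.
  have key : ∀ v, Relation.ReflTransGen ((grid n₁ n₂).induce {i | b.R i = b.R j}).Adj ⟨i, hij⟩ v →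
      s.R i = s.R v := by
    intro v hv
    induction hv with
    | refl => rfl
    | @tail c d _ hcd ih =>
      rw [ih]
      by_contra hne
      exact h c d hcd hne (c.2.trans d.2.symm)
  exact key _ hreach

end Model

/-! ### The penalty is negligible against `T`. -/

section Penalty

variable {n₁ n₂ W : ℕ}

/-- Nonnegativity is all that is needed for the fitted models; an upper bound is needed only for the
fixed true ones. -/
lemma penalty_nonneg (ψ : Model n₁ n₂ W) {len : ℝ} (hlen : 0 ≤ len) : 0 ≤ penalty ψ len := by
  have hlog3 : 0 ≤ Real.log 3 := Real.log_nonneg (by norm_num)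
  have h1 : 0 ≤ Real.log ((n₁ * n₂ : ℕ) : ℝ) := Real.log_natCast_nonneg _
  have h2 : ∀ h, 0 ≤ Real.log ((len + 1) * (ψ.area h : ℝ)) := fun h => by
    have : (1 : ℝ) ≤ ψ.area h := by exact_mod_cast ψ.one_le_area h
    exact Real.log_nonneg (by nlinarith)
  have h3 := Finset.sum_nonneg fun h (_ : h ∈ Finset.univ) => h2 h
  unfold penalty
  positivity

lemma penalty_le (ψ : Model n₁ n₂ W) {len T : ℝ} (hlen : 0 ≤ len) (hT : len ≤ T) :
    penalty ψ len ≤ penalty ψ 0 + (W : ℝ) / 2 * ψ.m * Real.log (T + 1) := by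
  have h2 : ∀ h, Real.log ((len + 1) * (ψ.area h : ℝ))
      ≤ Real.log ((0 + 1) * (ψ.area h : ℝ)) + Real.log (T + 1) := fun h => by
    have h0 : (0 : ℝ) < ψ.area h := by exact_mod_cast ψ.one_le_area h
    rw [Real.log_mul (by linarith) h0.ne', zero_add, one_mul, add_comm]
    gcongr
  have h3 := Finset.sum_le_sum fun h (_ : h ∈ Finset.univ) => h2 h
  rw [Finset.sum_add_distrib, Finset.sum_const, nsmul_eq_mul, Finset.card_univ,
    Fintype.card_fin] at h3
  have h4 := mul_le_mul_of_nonneg_left h3 (by positivity : (0 : ℝ) ≤ (W : ℝ) / 2)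
  unfold penalty
  linarith

lemma tendsto_penalty_div {K : ℕ} {ν : Fin K → ℝ} (h : Monotone (extend ν)) (ψ : Model n₁ n₂ W)
    (k : Fin (K + 1)) :
    Tendsto (fun T : ℕ =>
      penalty ψ ((changePoint T ν k.succ : ℝ) - (changePoint T ν k.castSucc : ℝ)) / T)
      atTop (𝓝 0) := by
  have hlen : ∀ T, (0 : ℝ) ≤ (changePoint T ν k.succ : ℝ) - (changePoint T ν k.castSucc : ℝ) :=
    fun T => by rw [← card_interval h]; positivity
  have hlen' : ∀ T : ℕ, (changePoint T ν k.succ : ℝ) - (changePoint T ν k.castSucc : ℝ) ≤ T :=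
    fun T => (sub_le_self _ (Nat.cast_nonneg _)).trans (by exact_mod_cast changePoint_le T h _)
  have hlog : Tendsto (fun T : ℕ => Real.log ((T : ℝ) + 1) / T) atTop (𝓝 0) := by
    have h1 : Tendsto (fun T : ℕ => (T : ℝ) + 1) atTop atTop :=
      tendsto_atTop_add_const_right _ _ tendsto_natCast_atTop_atTop
    have h2 := (Real.isLittleO_log_id_atTop.tendsto_div_nhds_zero).comp h1
    have h3 : Tendsto (fun T : ℕ => ((T : ℝ) + 1) / T) atTop (𝓝 1) := by
      have := (tendsto_one_div_atTop_nhds_zero_nat (𝕜 := ℝ)).const_add 1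
      rw [add_zero] at this
      refine this.congr' ?_
      filter_upwards [eventually_gt_atTop 0] with T hT
      have : (T : ℝ) ≠ 0 := by exact_mod_cast hT.ne'
      field_simp
    have h4 := h2.mul h3
    rw [zero_mul] at h4
    refine h4.congr fun T => ?_
    have : (T : ℝ) + 1 ≠ 0 := by positivity
    simp only [Function.comp_apply, id]
    field_simp
  have hup : Tendsto (fun T : ℕ => penalty ψ 0 / T
      + (W : ℝ) / 2 * ψ.m * (Real.log ((T : ℝ) + 1) / T)) atTop (𝓝 0) := by
    have := (tendsto_const_div_atTop_nhds_zero_nat (penalty ψ 0)).add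
      (hlog.const_mul ((W : ℝ) / 2 * ψ.m))
    simpa using this
  refine tendsto_of_tendsto_of_tendsto_of_le_of_le tendsto_const_nhds hup
    (fun T => div_nonneg (penalty_nonneg ψ (hlen T)) T.cast_nonneg) fun T => ?_
  have := div_le_div_of_nonneg_right (penalty_le ψ (hlen T) (hlen' T)) (T.cast_nonneg (α := ℝ))
  refine this.trans_eq ?_
  ring

end Penalty

/-! ### Deterministic consistency on a sample obeying the strong law. -/

section Consistency

variable {n₁ n₂ W K : ℕ} {ε : ℝ} {νo : Fin K → ℝ} {ψo : Fin (K + 1) → Model n₁ n₂ W}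
  {Y : ℕ → ℕ → Pixel n₁ n₂ → Fin W → ℕ}

/-- The number of counts of the pixel and band `p` in the interval `k`, divided by `T`. -/
def meanCount (Y : ℕ → ℕ → Pixel n₁ n₂ → Fin W → ℕ) (T : ℕ) (ν : Fin K → ℝ) (k : Fin (K + 1))
    (p : Pixel n₁ n₂ × Fin W) : ℝ :=
  (∑ t ∈ interval T ν k, (Y T t p.1 p.2 : ℝ)) / T

/-- The law of large numbers for all intervals, pixels and bands, at rational times. -/
def HasAverages (νo : Fin K → ℝ) (ψo : Fin (K + 1) → Model n₁ n₂ W)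
    (Y : ℕ → ℕ → Pixel n₁ n₂ → Fin W → ℕ) : Prop :=
  ∀ (j : Fin (K + 1)) (p : Pixel n₁ n₂ × Fin W) (q : ℚ),
    Tendsto (fun T : ℕ => (∑ t ∈ binsUpTo T νo j q, (Y T t p.1 p.2 : ℝ)) / T) atTop
      (𝓝 ((ψo j).rate p * lengthUpTo (extend νo) j (max q 0)))

lemma HasAverages.tendsto_meanCount (hY : HasAverages νo ψo Y) (ho : Monotone (extend νo))
    {F : Filter ℕ} (hF : F ≤ atTop) {ν : ℕ → Fin K → ℝ} (hν : ∀ᶠ T in F, Monotone (extend (ν T)))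
    {νs : Fin K → ℝ} (hνs : Monotone (extend νs)) (hlim : Tendsto ν F (𝓝 νs)) (k : Fin (K + 1))
    (p : Pixel n₁ n₂ × Fin W) :
    Tendsto (fun T => meanCount Y T (ν T) k p) F
      (𝓝 (∑ j, overlap (extend νo) (extend νs) k j * (ψo j).rate p)) := by
  have h1 : ∀ j m, Tendsto (fun T : ℕ =>
      (∑ t ∈ binsUpTo T νo j (extend (ν T) m), (Y T t p.1 p.2 : ℝ)) / T) F
      (𝓝 ((ψo j).rate p * lengthUpTo (extend νo) j (max (extend νs m) 0))) := fun j m =>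
    tendsto_apply_of_monotone
      (G := fun T u => (∑ t ∈ binsUpTo T νo j u, (Y T t p.1 p.2 : ℝ)) / T)
      (g := fun u => (ψo j).rate p * lengthUpTo (extend νo) j (max u 0))
      (fun T u v huv => div_le_div_of_nonneg_right (Finset.sum_le_sum_of_subset_of_nonneg
        (binsUpTo_mono T νo j huv) fun _ _ _ => Nat.cast_nonneg _) T.cast_nonneg)
      (continuous_const.mul ((continuous_lengthUpTo _ j).comp
        (continuous_id.max continuous_const)))
      (hY j p) hF (((continuous_extend m).tendsto νs).comp hlim)
  have h2 := tendsto_finsetSum Finset.univ fun j _ => (h1 j k.succ).sub (h1 j k.castSucc)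
  have h3 : ∑ j, ((ψo j).rate p * lengthUpTo (extend νo) j (max (extend νs k.succ) 0)
      - (ψo j).rate p * lengthUpTo (extend νo) j (max (extend νs k.castSucc) 0))
      = ∑ j, overlap (extend νo) (extend νs) k j * (ψo j).rate p := by
    refine Finset.sum_congr rfl fun j _ => ?_
    rw [max_eq_left (extend_nonneg hνs _), max_eq_left (extend_nonneg hνs _), overlap]
    ring
  rw [h3] at h2
  refine h2.congr' ?_
  filter_upwards [hν] with T hT
  rw [meanCount, sum_interval_eq ho hT, Finset.sum_div]
  exact Finset.sum_congr rfl fun j _ => (sub_div _ _ _).symm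

lemma tendsto_card_interval {F : Filter ℕ} (hF : F ≤ atTop) {ν : ℕ → Fin K → ℝ}
    (hν : ∀ᶠ T in F, Monotone (extend (ν T))) {νs : Fin K → ℝ} (hνs : Monotone (extend νs))
    (hlim : Tendsto ν F (𝓝 νs)) (k : Fin (K + 1)) :
    Tendsto (fun T => ((interval T (ν T) k).card : ℝ) / T) F
      (𝓝 (extend νs k.succ - extend νs k.castSucc)) := by
  have h1 : ∀ m, Tendsto (fun T : ℕ => (changePoint T (ν T) m : ℝ) / T) F (𝓝 (extend νs m)) := by
    intro m
    have := tendsto_apply_of_monotone (G := fun T u => (⌊(T : ℝ) * u⌋₊ : ℝ) / T)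
      (g := fun u => max u 0)
      (fun T u v huv => div_le_div_of_nonneg_right (Nat.cast_le.2
        (Nat.floor_mono (mul_le_mul_of_nonneg_left huv T.cast_nonneg))) T.cast_nonneg)
      (continuous_id.max continuous_const) (fun q => tendsto_floor_mul_div q) hF
      (((continuous_extend m).tendsto νs).comp hlim)
    simpa only [max_eq_left (extend_nonneg hνs m), Function.comp_apply, changePoint] using this
  refine ((h1 k.succ).sub (h1 k.castSucc)).congr' ?_
  filter_upwards [hν] with T hT
  rw [card_interval hT, sub_div]

/-- The truth is a competitor of the minimizer. The term `K log T` cancels since `K` is the same on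
both sides, and the fitted penalty is dropped. -/
lemma IsMDLEstimate.sum_likelihood_le {𝓜 : Set (Model n₁ n₂ W)} {T : ℕ} (hT : 0 < T)
    {ν : Fin K → ℝ} {ψ : Fin (K + 1) → Model n₁ n₂ W} (hε : 0 ≤ ε)
    (h : IsMDLEstimate ε 𝓜 T (Y T) ν ψ) (hνo : νo ∈ admissible K ε) (hψo : ∀ k, ψo k ∈ 𝓜) :
    ∑ k, ∑ p, (meanCount Y T νo k p * Real.log ((ψo k).rate p)
        - ((interval T νo k).card : ℝ) / T * (ψo k).rate p)
      - ∑ k, penalty (ψo k)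
          ((changePoint T νo k.succ : ℝ) - (changePoint T νo k.castSucc : ℝ)) / T
      ≤ ∑ k, ∑ p, (meanCount Y T ν k p * Real.log ((ψ k).rate p)
        - ((interval T ν k).card : ℝ) / T * (ψ k).rate p) := by
  have hT' : (0 : ℝ) < T := by exact_mod_cast hT
  have hmin := h.2 νo hνo ψo hψo
  rw [mul_le_mul_iff_right₀ (by positivity)] at hmin
  have hpen : 0 ≤ ∑ k, penalty (ψ k)
      ((changePoint T ν k.succ : ℝ) - (changePoint T ν k.castSucc : ℝ)) :=
    Finset.sum_nonneg fun k _ => penalty_nonneg _ (by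
      rw [← card_interval (strictMono_extend hε h.1.1).monotone]; positivity)
  have hrw : ∀ (ν : Fin K → ℝ) (ψ : Fin (K + 1) → Model n₁ n₂ W),
      ∑ k, ∑ p, (meanCount Y T ν k p * Real.log ((ψ k).rate p)
        - ((interval T ν k).card : ℝ) / T * (ψ k).rate p)
      = (∑ k, ∑ t ∈ interval T ν k, (ψ k).logLik (Y T t)) / T := by
    intro ν ψ
    simp_rw [Model.sum_logLik, Finset.sum_div, meanCount]
    refine Finset.sum_congr rfl fun k _ => Finset.sum_congr rfl fun p _ => ?_
    ring
  rw [hrw, hrw, ← Finset.sum_div, ← sub_div]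
  refine div_le_div_of_nonneg_right ?_ hT'.le
  unfold mdl at hmin
  linarith

/-- Along a filter on which the estimated change points converge, the true rates are constant on
the limit intervals and the estimated rates converge. -/
lemma HasAverages.tendsto_rate (hY : HasAverages νo ψo Y) (hε : 0 < ε)
    {𝓜 : Set (Model n₁ n₂ W)} (hνo : νo ∈ admissible K ε) (hψo : ∀ k, ψo k ∈ 𝓜)
    {F : Filter ℕ} [F.NeBot] (hF : F ≤ atTop) {ν : ℕ → Fin K → ℝ}
    {ψ : ℕ → Fin (K + 1) → Model n₁ n₂ W}
    (hest : ∀ᶠ T in F, IsMDLEstimate ε 𝓜 T (Y T) (ν T) (ψ T)) {νs : Fin K → ℝ}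
    (hlim : Tendsto ν F (𝓝 νs)) :
    StrictMono (extend νs) ∧
    (∀ k j p, 0 < overlap (extend νo) (extend νs) k j →
      Tendsto (fun T => (ψ T k).rate p) F (𝓝 ((ψo j).rate p))) := by
  have ho := strictMono_extend hε.le hνo
  have hν : ∀ᶠ T in F, Monotone (extend (ν T)) :=
    hest.mono fun T hT => (strictMono_extend hε.le hT.1.1).monotone
  -- The spacing `> ε` survives in the limit as `≥ ε`, so limit intervals do not collapse.
  have hs : StrictMono (extend νs) := Fin.strictMono_iff_lt_succ.2 fun k => by
    have h1 := (((continuous_extend k.succ).tendsto νs).comp hlim).sub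
      (((continuous_extend k.castSucc).tendsto νs).comp hlim)
    have h2 : ε ≤ extend νs k.succ - extend νs k.castSucc :=
      ge_of_tendsto h1 (hest.mono fun T hT => (hT.1.1.2.2 k).le)
    linarith
  refine ⟨hs, ?_⟩
  have hsum := sum_overlap_right (ν := νo) hs.monotone
  have hB : Tendsto (fun T : ℕ => ∑ k, ∑ p, (meanCount Y T νo k p * Real.log ((ψo k).rate p)
        - ((interval T νo k).card : ℝ) / T * (ψo k).rate p)
      - ∑ k, penalty (ψo k)
          ((changePoint T νo k.succ : ℝ) - (changePoint T νo k.castSucc : ℝ)) / T) atTop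
      (𝓝 (∑ j, ∑ p, (∑ k, overlap (extend νo) (extend νs) k j)
        * ((ψo j).rate p * Real.log ((ψo j).rate p) - (ψo j).rate p))) := by
    have h1 := (tendsto_finsetSum Finset.univ fun k _ => tendsto_finsetSum Finset.univ fun p _ =>
      ((hY.tendsto_meanCount ho.monotone le_rfl (.of_forall fun _ => ho.monotone) ho.monotone
        tendsto_const_nhds k p).mul_const (Real.log ((ψo k).rate p))).sub
        ((tendsto_card_interval le_rfl (.of_forall fun _ => ho.monotone) ho.monotone
        tendsto_const_nhds k).mul_const ((ψo k).rate p))).sub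
        (tendsto_finsetSum Finset.univ fun k _ => tendsto_penalty_div ho.monotone (ψo k) k)
    convert h1 using 2
    rw [Finset.sum_const_zero, sub_zero]
    refine Finset.sum_congr rfl fun j _ => Finset.sum_congr rfl fun p _ => ?_
    -- The true segmentation overlaps itself only on the diagonal, by the full interval length.
    rw [sum_overlap_left ho.monotone, Finset.sum_eq_single j, overlap]
    · have := ho (Fin.castSucc_lt_succ (i := j))
      unfold lengthUpTo
      rw [min_self, min_self, min_eq_right this.le, min_eq_left this.le]
      ring
    · intro k _ hk
      have h0 : overlap (extend νo) (extend νo) j k = 0 := by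
        unfold overlap lengthUpTo
        rcases lt_or_gt_of_ne hk with hlt | hlt
        · have h1 : extend νo k.succ ≤ extend νo j.castSucc :=
            ho.monotone (Fin.succ_le_castSucc_iff.2 hlt)
          have := ho (Fin.castSucc_lt_succ (i := j))
          have := ho (Fin.castSucc_lt_succ (i := k))
          grind
        · have h1 : extend νo j.succ ≤ extend νo k.castSucc :=
            ho.monotone (Fin.succ_le_castSucc_iff.2 hlt)
          have := ho (Fin.castSucc_lt_succ (i := j))
          have := ho (Fin.castSucc_lt_succ (i := k))
          grind
      rw [h0, zero_mul]
    · simp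
  obtain ⟨h1, h2⟩ := tendsto_rate_of_le_likelihood (F := F)
    (n := fun T k => ((interval T (ν T) k).card : ℝ) / T)
    (s := fun T k p => meanCount Y T (ν T) k p) (r := fun T k p => (ψ T k).rate p)
    (o := overlap (extend νo) (extend νs)) (lam := fun j p => (ψo j).rate p)
    (overlap_nonneg ho.monotone hs.monotone) (fun k p => (ψo k).rate_pos p)
    (fun k => by rw [hsum]; exact sub_pos.2 (hs (Fin.castSucc_lt_succ (i := k))))
    (fun k => by rw [hsum]; exact tendsto_card_interval hF hν hs.monotone hlim k)
    (hY.tendsto_meanCount ho.monotone hF hν hs.monotone hlim)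
    (fun T k p => div_nonneg (Finset.sum_nonneg fun _ _ => Nat.cast_nonneg _) T.cast_nonneg)
    (fun T k p => (ψ T k).rate_pos p) (hB.mono_left hF) (by
      filter_upwards [hest, hF (eventually_gt_atTop 0)] with T hT hT0
      exact hT.sum_likelihood_le hT0 hε.le hνo hψo)
  intro k j p hkj
  rw [h1 k j p hkj]
  exact h2 k p

/-- Consistency of the estimates on every sample that satisfies the law of large numbers. -/
theorem HasAverages.consistent (hY : HasAverages νo ψo Y) (hW : 0 < W) (hε : 0 < ε)
    {𝓜 : Set (Model n₁ n₂ W)} (hνo : νo ∈ admissible K ε) (hψo : ∀ k, ψo k ∈ 𝓜)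
    (hregions : ∀ k p q, (ψo k).NeighbouringRegions p q → ∀ w, (ψo k).μ p w ≠ (ψo k).μ q w)
    (hintervals : ∀ k : Fin K, ∃ p, (ψo k.succ).rate p ≠ (ψo k.castSucc).rate p)
    {ν : ℕ → Fin K → ℝ} {ψ : ℕ → Fin (K + 1) → Model n₁ n₂ W}
    (hest : ∀ᶠ T in atTop, IsMDLEstimate ε 𝓜 T (Y T) (ν T) (ψ T)) :
    Tendsto ν atTop (𝓝 νo) ∧ ∀ᶠ T in atTop, ∀ k, (ψ T k).Oversegments (ψo k) := by
  have ho := strictMono_extend hε.le hνo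
  have hconv : Tendsto ν atTop (𝓝 νo) := by
    -- Ultrafilters replace subsequences: along each one, compactness of the cube provides a limit
    -- to be identified.
    refine (tendsto_iff_ultrafilter _ _ _).2 fun U hU => ?_
    have hmem : ∀ᶠ T in (U : Filter ℕ), ν T ∈ Set.Icc (0 : Fin K → ℝ) 1 :=
      (hest.filter_mono hU).mono fun T hT => ⟨fun k => (hT.1.1.1 k).1.le, fun k => (hT.1.1.1 k).2.le⟩
    obtain ⟨νs, -, hνs⟩ := isCompact_Icc.ultrafilter_le_nhds (U.map ν)
      (le_principal_iff.2 hmem)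
    have hlim : Tendsto ν U (𝓝 νs) := hνs
    obtain ⟨hs, hrate⟩ := hY.tendsto_rate hε hνo hψo hU (hest.filter_mono hU) hlim
    -- A limit interval meeting true intervals `j` and `j + 1` would give the same fitted rate two
    -- different limits.
    have : νs = νo := eq_of_overlap ho hs fun k j h1 h2 => by
      obtain ⟨p, hp⟩ := hintervals j
      exact hp (tendsto_nhds_unique (hrate k _ p h2) (hrate k _ p h1))
    rwa [this] at hlim
  refine ⟨hconv, eventually_all.2 fun k => ?_⟩
  have hov : 0 < overlap (extend νo) (extend νo) k k :=
    overlap_pos (by simpa using ho (Fin.castSucc_lt_succ (i := k)))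
  have hrate := fun p => (hY.tendsto_rate hε hνo hψo le_rfl hest hconv).2 k k p hov
  have hsep : ∀ᶠ T in atTop, ∀ i j, (grid n₁ n₂).Adj i j → (ψo k).R i ≠ (ψo k).R j →
      (ψ T k).R i ≠ (ψ T k).R j := by
    refine eventually_all.2 fun i => eventually_all.2 fun j => ?_
    by_cases hij : (grid n₁ n₂).Adj i j ∧ (ψo k).R i ≠ (ψo k).R j
    -- One band suffices: merging `i` and `j` would make their fitted rates equal, although the
    -- limits differ.
    · have hne : (ψo k).rate (i, ⟨0, hW⟩) ≠ (ψo k).rate (j, ⟨0, hW⟩) :=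
        hregions k _ _ ⟨hij.2, i, j, hij.1, rfl, rfl⟩ _
      have hsub := ((hrate (i, ⟨0, hW⟩)).sub (hrate (j, ⟨0, hW⟩))).eventually_ne
        (sub_ne_zero.2 hne)
      filter_upwards [hsub] with T hT _ _ heq
      exact hT (by simp only [Model.rate, heq, sub_self])
    · exact .of_forall fun T h1 h2 => absurd ⟨h1, h2⟩ hij
  exact hsep.mono fun T hT => Model.oversegments_of_adj hT

end Consistency

/-! ### From the strong law to almost every sample. -/

open MeasureTheory ProbabilityTheory in
lemma IsObserved.ae_hasAverages {Ω : Type*} [MeasurableSpace Ω] {P : Measure Ω}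
    [IsProbabilityMeasure P] {n₁ n₂ W K : ℕ} {νo : Fin K → ℝ} {ψo : Fin (K + 1) → Model n₁ n₂ W}
    {y : ℕ → ℕ → Pixel n₁ n₂ → Fin W → Ω → ℕ} (hy : IsObserved P νo ψo y)
    (ho : Monotone (extend νo)) :
    ∀ᵐ ω ∂P, HasAverages νo ψo fun T t i w => y T t i w ω := by
  -- Restricting to rational times leaves countably many exceptional null sets.
  refine ae_all_iff.2 fun j => ae_all_iff.2 fun p => ae_all_iff.2 fun q => ?_
  have hsub : ∀ T, binsUpTo T νo j q ⊆ Finset.Icc 1 T := fun T =>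
    (binsUpTo_subset_interval T νo j q).trans (interval_subset ho T j)
  have := ae_tendsto_poisson_average (P := P) (Z := fun T t => y T t p.1 p.2)
    (s := fun T => binsUpTo T νo j q) (r := Real.toNNReal ((ψo j).rate p))
    (fun T => (hy.indep T).precomp (g := fun t : binsUpTo T νo j q => (⟨t, hsub T t.2⟩, p))
      fun a b hab => Subtype.ext (congrArg (fun c => (c.1 : ℕ)) hab))
    (fun T t ht => hy.law T j t (binsUpTo_subset_interval T νo j q ht) p.1 p.2)
    (fun T => by simpa using Finset.card_le_card (hsub T))
    (tendsto_card_binsUpTo ho j q)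
  simpa only [Real.coe_toNNReal _ ((ψo j).rate_pos p).le] using this

end ImageSeries

end

open MeasureTheory ProbabilityTheory Filter Topology ImageSeries in
theorem theorem1 {Ω : Type*} [MeasurableSpace Ω] (P : Measure Ω) [IsProbabilityMeasure P]
    (n₁ n₂ W K : ℕ) (hW : 0 < W)
    (ε : ℝ) (hε : 0 < ε)
    -- the class of models, the true change points and the true models
    (𝓜 : Set (Model n₁ n₂ W))
    (νo : Fin K → ℝ) (hνo : νo ∈ admissible K ε)
    (ψo : Fin (K + 1) → Model n₁ n₂ W) (hψo : ∀ k, ψo k ∈ 𝓜)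
    -- neighbouring regions have different rates in every band
    (hregions : ∀ k p q, (ψo k).NeighbouringRegions p q →
      ∀ w, 0 < |(ψo k).μ p w - (ψo k).μ q w|)
    -- the images of two neighbouring intervals are different
    (hintervals : ∀ k : Fin K, ∃ i w,
      0 < |(ψo k.succ).μ ((ψo k.succ).R i) w - (ψo k.castSucc).μ ((ψo k.castSucc).R i) w|)
    -- the data
    (y : ℕ → ℕ → Pixel n₁ n₂ → Fin W → Ω → ℕ) (hy : IsObserved P νo ψo y)
    -- the estimates
    (νhat : ℕ → Ω → Fin K → ℝ) (ψhat : ℕ → Ω → Fin (K + 1) → Model n₁ n₂ W)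
    (hhat : ∀ᵐ ω ∂P, ∀ᶠ T in atTop,
      IsMDLEstimate ε 𝓜 T (fun t i w => y T t i w ω) (νhat T ω) (ψhat T ω)) :
    ∀ᵐ ω ∂P, Tendsto (fun T => νhat T ω) atTop (𝓝 νo) ∧
      ∀ᶠ T in atTop, ∀ k, (ψhat T ω k).Oversegments (ψo k) := by
  filter_upwards [hy.ae_hasAverages (strictMono_extend hε.le hνo).monotone, hhat] with ω hω hest
  refine hω.consistent hW hε hνo hψo
    (fun k p q hpq w => sub_ne_zero.1 (abs_pos.1 (hregions k p q hpq w))) (fun k => ?_) hest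
  obtain ⟨i, w, hiw⟩ := hintervals k
  exact ⟨(i, w), sub_ne_zero.1 (abs_pos.1 hiw)⟩
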